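/- Let $a,c$ be integers with $1\le a<c$, let $s\ge 1$ be an integer, and let $\ell\ge 0$ be an integer with $(\ell+1)a<c$. For every integer $k\ge 1$ let $A_s(k)$ denote the number of lattice walks in $\mathbb{N}^2$ that start at $(0,0)$, end at $(cs-1,\,as-1)$, consist of East steps $(1,0)$ and North steps $(0,1)$, and stay strictly below the line $y=\frac{a}{c}x+\frac{k}{c}$ (that is, every vertex $(x,y)$ of the walk, including both end points, satisfies $y<\frac{a}{c}x+\frac{k}{c}$). Then $$\sum_{k=\ell a+1}^{(\ell+1)a} A_s(k)=\frac{\ell a+c}{(a+c)s+\ell-1}\binom{(a+c)s+\ell-1}{as-1}.$$ -/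

import Mathlib

namespace RationalSlope

/-- The two allowed steps of a walk: East `(1, 0)` and North `(0, 1)`. -/
inductive Step where
  | east
  | north

/-- The displacement vector of a step. -/
def Step.vec : Step → ℕ × ℕ
  | .east => (1, 0)
  | .north => (0, 1)

/-- The end point in `ℕ²` of the walk that starts at the origin and performs the given steps. -/
def endpoint (w : List Step) : ℕ × ℕ := (w.map Step.vec).sum

/-- The North-East walks that start at the origin, end at `(X, Y)`, and all of whose vertices
(the end points of the prefixes, the origin and `(X, Y)` included)
lie strictly below the line `y = α x + β`. -/
def walksBelow (α β : ℚ) (X Y : ℕ) : Set (List Step) :=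
  {w | endpoint w = (X, Y) ∧
    ∀ v : List Step, v <+: w → ((endpoint v).2 : ℚ) < α * ((endpoint v).1 : ℚ) + β}

/-- The number of North-East walks from the origin to `(X, Y)` that stay strictly below
the line `y = α x + β`. -/
noncomputable def numWalksBelow (α β : ℚ) (X Y : ℕ) : ℕ := (walksBelow α β X Y).ncard

/-- The number of steps of a walk is the sum of the coordinates of its end point. -/
theorem length_eq (w : List Step) : w.length = (endpoint w).1 + (endpoint w).2 := by
  induction w with
  | nil => rfl
  | cons s w ih =>
    cases s <;> simp only [endpoint, Step.vec, List.map_cons, List.sum_cons, List.length_cons,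
      Prod.fst_add, Prod.snd_add] at ih ⊢ <;> omega

instance : Finite Step :=
  Finite.of_surjective (fun b : Bool => if b then Step.east else Step.north)
    (fun s => by cases s; exacts [⟨true, rfl⟩, ⟨false, rfl⟩])

/-- The set of walks that is counted is finite. -/
theorem walksBelow_finite (α β : ℚ) (X Y : ℕ) : (walksBelow α β X Y).Finite := by
  refine (List.finite_length_eq Step (X + Y)).subset ?_
  rintro w ⟨hw, -⟩
  simp [length_eq w, hw]

end RationalSlope

/-!
Give an East step the increment `a` and a North step the increment `-c`. A walk stays strictly below
the line `y = (a x + k) / c` exactly when the walk of heights that starts at `k` stays positive.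

If `0 < k ≤ c`, a North step from height `k` is impossible, so the first step is East. Hence, since
`(ℓ + 1) a < c`, walks to `(X, Y)` with offset `ℓ a + k`, where `1 ≤ k ≤ a`, correspond to walks to
`(X + ℓ, Y)` with offset `k`: the first `ℓ` steps of the latter are forced
(`card_filter_walksTo_add`).

It remains to sum over the offsets `1, …, a`, which is done by a form of the cycle lemma. Let `m w`
be the least height of a vertex of `w`. The number of `k` in `[1, a]` for which `w` with offset `k`
stays positive is `max 0 (a + m w)`. Call this the gain of the walk `east :: w`, and more generally
call `max 0 (δ x + m w)`, with `δ x` the increment of the step `x`, the gain of `x :: w`; it is `0`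
for `x = north`. If the total height `T` of `x :: w` is nonnegative, then the gain of `x :: w`
is `δ x + m (w ++ [x]) - m (x :: w)`. Along the rotations of a walk this telescopes, so the gains of
all rotations add up to `T` (`sum_gain_rotate`). Summing over all walks with `X + 1` East and `Y`
North steps, of which there are `(X + 1 + Y).choose Y`, and using that rotation permutes them, one
obtains `(X + 1 + Y)` times the wanted sum on one side and `T` times the binomial coefficient
on the other.
-/

namespace RationalSlope

/-! ### Heights of walks -/

/-- The change of `a x - c y` along a step. -/
def Step.incr (a c : ℤ) : Step → ℤ
  | .east => a
  | .north => -c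

/-- The value of `a x - c y` at the end point of a walk, as a sum of increments. -/
def height (a c : ℤ) (w : List Step) : ℤ := (w.map (Step.incr a c)).sum

/-- The least height of a vertex of the walk, the origin included. -/
def minHeight (a c : ℤ) : List Step → ℤ
  | [] => 0
  | x :: w => min 0 (x.incr a c + minHeight a c w)

@[simp] theorem height_nil (a c : ℤ) : height a c [] = 0 := rfl

@[simp] theorem height_cons (a c : ℤ) (x : Step) (w : List Step) :
    height a c (x :: w) = x.incr a c + height a c w := by
  simp [height]

@[simp] theorem endpoint_nil : endpoint [] = (0, 0) := rfl

@[simp] theorem endpoint_cons (x : Step) (w : List Step) :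
    endpoint (x :: w) = x.vec + endpoint w := by
  simp [endpoint]

theorem height_eq (a c : ℤ) (w : List Step) :
    height a c w = a * (endpoint w).1 - c * (endpoint w).2 := by
  induction w with
  | nil => simp
  | cons x w ih => cases x <;> simp [ih, Step.incr, Step.vec] <;> ring

theorem minHeight_nonpos (a c : ℤ) (w : List Step) : minHeight a c w ≤ 0 := by
  cases w <;> simp [minHeight]

theorem minHeight_concat (a c : ℤ) (w : List Step) (x : Step) :
    minHeight a c (w ++ [x]) = min (minHeight a c w) (height a c w + x.incr a c) := by
  induction w with
  | nil => simp [minHeight]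
  | cons y w ih => simp only [List.cons_append, minHeight, ih, height_cons]; omega

theorem pos_add_minHeight_iff (a c k : ℤ) (w : List Step) :
    0 < k + minHeight a c w ↔ ∀ v : List Step, v <+: w → 0 < k + height a c v := by
  induction w generalizing k with
  | nil => simp [minHeight]
  | cons x w ih =>
    have := ih (k + x.incr a c)
    constructor
    · intro h v hv
      rcases v with _ | ⟨y, v⟩
      · simp only [minHeight, height_nil] at h ⊢; omega
      · obtain ⟨rfl, hvw⟩ := List.cons_prefix_cons.1 hv
        have := this.1 (by simp only [minHeight] at h; omega) v hvw
        simp only [height_cons]; omega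
    · intro h
      have h0 := h [] List.nil_prefix
      have h1 := this.2 fun v hv => by
        have := h (x :: v) (List.cons_prefix_cons.2 ⟨rfl, hv⟩)
        simp only [height_cons] at this; omega
      simp only [minHeight, height_nil] at h0 ⊢; omega

/-! ### Walks with a prescribed end point -/

theorem finite_endpoint_eq (X Y : ℕ) : {w | endpoint w = (X, Y)}.Finite := by
  refine (List.finite_length_eq Step (X + Y)).subset fun w hw => ?_
  have hw : endpoint w = (X, Y) := hw
  simp [length_eq w, hw]

/-- The finite set of all walks from the origin to `(X, Y)`. -/
noncomputable def walksTo (X Y : ℕ) : Finset (List Step) := (finite_endpoint_eq X Y).toFinset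

@[simp] theorem mem_walksTo {X Y : ℕ} {w : List Step} : w ∈ walksTo X Y ↔ endpoint w = (X, Y) := by
  simp [walksTo]

theorem length_of_mem_walksTo {X Y : ℕ} {w : List Step} (hw : w ∈ walksTo X Y) :
    w.length = X + Y := by
  rw [length_eq, mem_walksTo.1 hw]

theorem numWalksBelow_eq_card {a c k : ℕ} (hc : 0 < c) (X Y : ℕ) :
    numWalksBelow ((a : ℚ) / (c : ℚ)) ((k : ℚ) / (c : ℚ)) X Y =
      ((walksTo X Y).filter fun w => 0 < (k : ℤ) + minHeight a c w).card := by
  rw [numWalksBelow, ← Set.ncard_coe_finset]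
  congr 1
  ext w
  simp only [walksBelow, Set.mem_ofPred_eq, Finset.coe_filter, mem_walksTo, pos_add_minHeight_iff]
  refine and_congr_right fun _ => forall₂_congr fun v _ => ?_
  rw [div_mul_eq_mul_div, ← add_div, lt_div_iff₀ (by exact_mod_cast hc), height_eq]
  have : (((endpoint v).2 : ℚ) * c < a * (endpoint v).1 + k) ↔
      (((endpoint v).2 : ℤ) * c < a * (endpoint v).1 + k) := by exact_mod_cast Iff.rfl
  rw [this, mul_comm (c : ℤ)]
  constructor <;> intro h <;> linarith

theorem walksTo_zero_right (X : ℕ) : (walksTo X 0).card = 1 := by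
  rw [Finset.card_eq_one]
  refine ⟨List.replicate X .east, ?_⟩
  ext w
  rw [mem_walksTo, Finset.mem_singleton]
  induction w generalizing X with
  | nil => cases X <;> simp [List.replicate_succ]
  | cons x w ih =>
    rcases X with _ | X <;> cases x <;>
      simp [List.replicate_succ, Step.vec, Prod.ext_iff, ← ih]
    · omega

theorem walksTo_zero_left (Y : ℕ) : (walksTo 0 Y).card = 1 := by
  rw [Finset.card_eq_one]
  refine ⟨List.replicate Y .north, ?_⟩
  ext w
  rw [mem_walksTo, Finset.mem_singleton]
  induction w generalizing Y with
  | nil => cases Y <;> simp [List.replicate_succ]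
  | cons x w ih =>
    rcases Y with _ | Y <;> cases x <;>
      simp [List.replicate_succ, Step.vec, Prod.ext_iff, ← ih]
    · omega

theorem east_cons_mem_walksTo {X Y : ℕ} {w : List Step} :
    Step.east :: w ∈ walksTo (X + 1) Y ↔ w ∈ walksTo X Y := by
  simp only [mem_walksTo, endpoint_cons, Step.vec, Prod.ext_iff, Prod.fst_add, Prod.snd_add]
  omega

theorem north_cons_mem_walksTo {X Y : ℕ} {w : List Step} :
    Step.north :: w ∈ walksTo X (Y + 1) ↔ w ∈ walksTo X Y := by
  simp only [mem_walksTo, endpoint_cons, Step.vec, Prod.ext_iff, Prod.fst_add, Prod.snd_add]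
  omega

theorem sum_walksTo_succ {M : Type*} [AddCommMonoid M] (X Y : ℕ) (g : List Step → M)
    (hg : ∀ w, g (.north :: w) = 0) :
    ∑ w ∈ walksTo (X + 1) Y, g w = ∑ w ∈ walksTo X Y, g (.east :: w) := by
  symm
  refine Finset.sum_of_injOn (List.cons .east) (List.cons_injective.injOn) ?_ ?_ fun _ _ => rfl
  · exact fun w hw => east_cons_mem_walksTo.2 hw
  · rintro (_ | ⟨_ | _, w⟩) hw hw'
    · simp at hw
    · exact absurd ⟨w, east_cons_mem_walksTo.1 hw, rfl⟩ hw'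
    · exact hg w

theorem card_walksTo (X Y : ℕ) : (walksTo X Y).card = (X + Y).choose Y := by
  induction X generalizing Y with
  | zero => simp [walksTo_zero_left]
  | succ X ihX =>
    induction Y with
    | zero => simp [walksTo_zero_right]
    | succ Y ihY =>
      have hdisj : Disjoint ((walksTo X (Y + 1)).map ⟨_, List.cons_injective (a := .east)⟩)
          ((walksTo (X + 1) Y).map ⟨_, List.cons_injective (a := .north)⟩) := by
        simp [Finset.disjoint_left]
      have : walksTo (X + 1) (Y + 1) = Finset.disjUnion _ _ hdisj := by
        ext (_ | ⟨_ | _, w⟩)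
        · simp
        · simp [-mem_walksTo, east_cons_mem_walksTo]
        · simp [-mem_walksTo, north_cons_mem_walksTo]
      rw [this, Finset.card_disjUnion, Finset.card_map, Finset.card_map, ihX, ihY,
        show X + 1 + (Y + 1) = X + 1 + Y + 1 by ring, Nat.choose_succ_succ,
        show X + (Y + 1) = X + 1 + Y by ring, add_comm]

/-! ### Forced initial East steps -/

theorem card_filter_walksTo_succ {a c k : ℤ} (hk : 0 < k) (hkc : k ≤ c) (X Y : ℕ) :
    ((walksTo (X + 1) Y).filter fun w => 0 < k + minHeight a c w).card =
      ((walksTo X Y).filter fun w => 0 < k + a + minHeight a c w).card := by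
  rw [Finset.card_filter, Finset.card_filter, sum_walksTo_succ]
  · refine Finset.sum_congr rfl fun w _ => if_congr ?_ rfl rfl
    simp only [minHeight, Step.incr]
    omega
  · intro w
    have := minHeight_nonpos a c w
    refine if_neg ?_
    simp only [minHeight, Step.incr]
    omega

theorem card_filter_walksTo_add {a c : ℤ} (ha : 0 < a) (X Y ℓ : ℕ) {k : ℤ} (hk : 0 < k)
    (hkc : k + ℓ * a ≤ c) :
    ((walksTo (X + ℓ) Y).filter fun w => 0 < k + minHeight a c w).card =
      ((walksTo X Y).filter fun w => 0 < ℓ * a + k + minHeight a c w).card := by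
  induction ℓ generalizing k with
  | zero => simp
  | succ ℓ ih =>
    have h : 0 ≤ (ℓ : ℤ) * a := by positivity
    push_cast at hkc ⊢
    rw [← add_assoc X, card_filter_walksTo_succ hk (by linarith), ih (by linarith) (by linarith)]
    simp only [add_mul, one_mul, add_assoc, add_comm a]

/-! ### The cycle lemma -/

/-- If the walk has nonnegative height and is repeated periodically, this is the amount by which
the least height still to come increases when the first step is performed. For a walk `east :: w`
it is the number of offsets in `[1, a]` with which `w` stays positive. -/
def gain (a c : ℤ) : List Step → ℤ
  | [] => 0
  | x :: w => max 0 (x.incr a c + minHeight a c w)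

theorem gain_cons {a c : ℤ} {x : Step} {w : List Step} (h : 0 ≤ height a c (x :: w)) :
    gain a c (x :: w) =
      x.incr a c + minHeight a c (w ++ [x]) - minHeight a c (x :: w) := by
  have := minHeight_nonpos a c w
  rw [height_cons] at h
  simp only [gain, minHeight_concat, minHeight]
  omega

theorem rotate_mem_walksTo {X Y : ℕ} {w : List Step} (i : ℕ) :
    w.rotate i ∈ walksTo X Y ↔ w ∈ walksTo X Y := by
  simp only [mem_walksTo, endpoint, ((List.rotate_perm w i).map Step.vec).sum_eq]

theorem height_rotate (a c : ℤ) (w : List Step) (i : ℕ) :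
    height a c (w.rotate i) = height a c w :=
  ((List.rotate_perm w i).map _).sum_eq

/-- The telescoping sum of gains: after the part `u` of the walk `u ++ v` has been rotated to the
end, the least height is `height u + minHeight (v ++ u)` relative to the original origin. -/
theorem sum_gain_append_rotate {a c : ℤ} (u v : List Step) (h : 0 ≤ height a c (u ++ v)) :
    ∑ i ∈ Finset.range u.length, gain a c ((u ++ v).rotate i) =
      height a c u + minHeight a c (v ++ u) - minHeight a c (u ++ v) := by
  induction u generalizing v with
  | nil => simp
  | cons x u ih =>
    have hrot : (x :: (u ++ v)).rotate 1 = u ++ (v ++ [x]) := by simp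
    have h' : 0 ≤ height a c (u ++ (v ++ [x])) := by rwa [← hrot, height_rotate]
    have hi (i : ℕ) : (x :: u ++ v).rotate (i + 1) = (u ++ (v ++ [x])).rotate i := by
      rw [← hrot, List.rotate_rotate, add_comm 1 i, List.cons_append]
    rw [List.length_cons, Finset.sum_range_succ']
    simp only [hi, List.rotate_zero]
    rw [List.cons_append] at h ⊢
    rw [ih _ h', gain_cons h]
    simp only [height_cons, List.append_assoc, List.cons_append, List.nil_append]
    ring

/-- The cycle lemma: the gains of all rotations of a walk add up to its height. -/
theorem sum_gain_rotate {a c : ℤ} {w : List Step} (h : 0 ≤ height a c w) :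
    ∑ i ∈ Finset.range w.length, gain a c (w.rotate i) = height a c w := by
  simpa using sum_gain_append_rotate w [] (by simpa using h)

theorem length_mul_sum_gain {a c T : ℤ} {X Y : ℕ} (hT : a * X - c * Y = T) (h : 0 ≤ T) :
    ((X + Y : ℕ) : ℤ) * ∑ w ∈ walksTo X Y, gain a c w = T * ((X + Y).choose Y : ℕ) := by
  have hrot (i : ℕ) :
      ∑ w ∈ walksTo X Y, gain a c (w.rotate i) = ∑ w ∈ walksTo X Y, gain a c w := by
    -- rotation is injective and preserves the finite set `walksTo X Y`, hence permutes it
    have hmaps : Set.MapsTo (fun w : List Step => w.rotate i) (walksTo X Y) (walksTo X Y) :=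
      fun w hw => (rotate_mem_walksTo i).2 hw
    have hinj : Set.InjOn (fun w : List Step => w.rotate i) (walksTo X Y) :=
      (List.rotate_injective i).injOn
    exact Finset.sum_nbij _ hmaps hinj (Finset.surjOn_of_injOn_of_card_le _ hmaps hinj le_rfl)
      fun _ _ => rfl
  calc ((X + Y : ℕ) : ℤ) * ∑ w ∈ walksTo X Y, gain a c w
      = ∑ i ∈ Finset.range (X + Y), ∑ w ∈ walksTo X Y, gain a c (w.rotate i) := by
        simp [hrot]
    _ = ∑ w ∈ walksTo X Y, T := by
        rw [Finset.sum_comm]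
        refine Finset.sum_congr rfl fun w hw => ?_
        have hw' : height a c w = T := by rw [height_eq, mem_walksTo.1 hw, hT]
        rw [← length_of_mem_walksTo hw, sum_gain_rotate (hw' ▸ h), hw']
    _ = T * ((X + Y).choose Y : ℕ) := by
        rw [Finset.sum_const, card_walksTo, nsmul_eq_mul, mul_comm]

theorem sum_gain_eq_sum_card (a c X Y : ℕ) :
    ∑ w ∈ walksTo (X + 1) Y, gain a c w =
      ∑ k ∈ Finset.Icc 1 a,
        (((walksTo X Y).filter fun w => 0 < (k : ℤ) + minHeight a c w).card : ℤ) := by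
  rw [sum_walksTo_succ]
  · simp only [Finset.card_filter, Nat.cast_sum]
    rw [Finset.sum_comm]
    refine Finset.sum_congr rfl fun w _ => ?_
    have hw := minHeight_nonpos a c w
    rw [← Nat.cast_sum, ← Finset.card_filter]
    have : (Finset.Icc 1 a).filter (fun k : ℕ => 0 < (k : ℤ) + minHeight a c w) =
        Finset.Icc ((-minHeight a c w).toNat + 1) a := by
      ext k
      simp only [Finset.mem_filter, Finset.mem_Icc]
      omega
    rw [this, Nat.card_Icc]
    simp only [gain, Step.incr]
    omega
  · intro w
    have := minHeight_nonpos a c w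
    simp only [gain, Step.incr]
    omega

end RationalSlope

open RationalSlope in
theorem mainTheorem3 (a c s ℓ : ℕ) (ha : 0 < a) (hac : a < c) (hs : 1 ≤ s)
    (hℓ : (ℓ + 1) * a < c) :
    ∑ k ∈ Finset.Icc (ℓ * a + 1) ((ℓ + 1) * a),
        (RationalSlope.numWalksBelow ((a : ℚ) / (c : ℚ)) ((k : ℚ) / (c : ℚ))
          (c * s - 1) (a * s - 1) : ℚ) =
      ((ℓ : ℚ) * (a : ℚ) + (c : ℚ)) /
          (((a : ℚ) + (c : ℚ)) * (s : ℚ) + (ℓ : ℚ) - 1) *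
        (Nat.choose ((a + c) * s + ℓ - 1) (a * s - 1) : ℚ) := by
  have hc : 0 < c := by omega
  obtain ⟨X, hX⟩ : ∃ X, c * s = X + 1 :=
    Nat.exists_eq_add_one.2 (Nat.mul_pos hc hs)
  obtain ⟨Y, hY⟩ : ∃ Y, a * s = Y + 1 :=
    Nat.exists_eq_add_one.2 (Nat.mul_pos ha hs)
  have hn : (a + c) * s + ℓ = (X + ℓ + 1 + Y) + 1 := by rw [add_mul, hX, hY]; ring
  have hnQ : ((a : ℚ) + c) * s + ℓ - 1 = ((X + ℓ + 1 + Y : ℕ) : ℚ) := by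
    rw [sub_eq_iff_eq_add]; exact_mod_cast hn
  rw [hX, hY, hn, hnQ, Nat.add_sub_cancel, Nat.add_sub_cancel, Nat.add_sub_cancel]
  have hsum : ∑ k ∈ Finset.Icc (ℓ * a + 1) ((ℓ + 1) * a),
      (numWalksBelow ((a : ℚ) / (c : ℚ)) ((k : ℚ) / (c : ℚ)) X Y : ℤ) =
      ∑ w ∈ walksTo (X + ℓ + 1) Y, gain a c w := by
    rw [sum_gain_eq_sum_card, show ℓ * a + 1 = 1 + ℓ * a by ring,
      show (ℓ + 1) * a = a + ℓ * a by ring, ← Finset.map_add_right_Icc, Finset.sum_map]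
    refine Finset.sum_congr rfl fun k hk => ?_
    rw [Finset.mem_Icc] at hk
    have hkc : k + ℓ * a ≤ c := by linarith
    rw [numWalksBelow_eq_card hc, card_filter_walksTo_add (by exact_mod_cast ha) X Y ℓ
      (by exact_mod_cast hk.1) (by exact_mod_cast hkc)]
    simp [add_comm (k : ℤ)]
  have hT : (a : ℤ) * (X + ℓ + 1 : ℕ) - c * Y = ℓ * a + c := by
    zify at hX hY
    push_cast
    linear_combination -(a : ℤ) * hX + (c : ℤ) * hY
  have key := length_mul_sum_gain hT (by positivity)
  rw [← hsum] at key
  have keyQ : ((X + ℓ + 1 + Y : ℕ) : ℚ) * ∑ k ∈ Finset.Icc (ℓ * a + 1) ((ℓ + 1) * a),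
      (numWalksBelow ((a : ℚ) / (c : ℚ)) ((k : ℚ) / (c : ℚ)) X Y : ℚ) =
      (ℓ * a + c) * ((X + ℓ + 1 + Y).choose Y : ℕ) := by exact_mod_cast key
  have hpos : ((X + ℓ + 1 + Y : ℕ) : ℚ) ≠ 0 := by exact_mod_cast (by omega)
  rw [div_mul_eq_mul_div, eq_div_iff hpos, ← keyQ, mul_comm]
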